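/- Let $\mathfrak A$ be a unital $C^*$-algebra, let $\theta,\alpha\in\mathrm{Aut}(\mathfrak A)$ be $*$-automorphisms, and let $u\in\mathfrak A$ be a unitary such that $u\,\alpha(\theta(a))=\theta(\alpha(a))\,u$ for all $a\in\mathfrak A$. Let $\mathfrak A\rtimes_\alpha\mathbb Z$ be the $C^*$-crossed product, i.e. the completion, in the maximal $C^*$-norm, of the $*$-algebra of finite sums $\sum_n V^na_n$ ($a_n\in\mathfrak A$), where $V$ is a unitary with $VaV^*=\alpha(a)$. Let $\Phi_{\theta,u}$ be the $*$-automorphism of $\mathfrak A\rtimes_\alpha\mathbb Z$ determined by $\Phi_{\theta,u}(a)=\theta(a)$ for $a\in\mathfrak A$ and $\Phi_{\theta,u}(V)=uV$. Let $E:\mathfrak A\rtimes_\alpha\mathbb Z\to\mathfrak A$, $E(x)=\oint\rho_z(x)\frac{dz}{2\pi\imath z}$, be the conditional expectation obtained by averaging the gauge action $\rho_z(a)=a$, $\rho_z(V)=zV$ ($a\in\mathfrak A$, $|z|=1$). Suppose that $(\mathfrak A,\theta)$ is uniquely ergodic, i.e. there is exactly one $\theta$-invariant state $\omega_o$ on $\mathfrak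 A$, and put $\omega:=\omega_o\circ E$. Then $(\mathfrak A\rtimes_\alpha\mathbb Z,\Phi_{\theta,u})$ is uniquely ergodic with $\omega$ as its unique invariant state if and only if $(\mathfrak A\rtimes_\alpha\mathbb Z,\Phi_{\theta,u},\omega)$ is ergodic, i.e. if and only if $\omega$ is an extreme point of the convex set of $\Phi_{\theta,u}$-invariant states of $\mathfrak A\rtimes_\alpha\mathbb Z$. -/

import Mathlib

open UniformSpace
open scoped CStarAlgebra

noncomputable section

/-- A `C⋆`-seminorm on a complex `⋆`-algebra. -/
structure CStarSeminorm (R : Type*) [Ring R] [Algebra ℂ R] [Star R] extends Seminorm ℂ R where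
  mul_le' : ∀ x y : R, toFun (x * y) ≤ toFun x * toFun y
  star_mul_self' : ∀ x : R, toFun (star x * x) = toFun x * toFun x

namespace CStarSeminorm

variable {R S : Type*} [Ring R] [StarRing R] [Algebra ℂ R] [Ring S] [StarRing S] [Algebra ℂ S]

instance : CoeFun (CStarSeminorm R) fun _ ↦ R → ℝ := ⟨fun p ↦ p.toSeminorm⟩

lemma mul_le (p : CStarSeminorm R) (x y : R) : p (x * y) ≤ p x * p y := p.mul_le' x y

lemma star_mul_self (p : CStarSeminorm R) (x : R) : p (star x * x) = p x * p x :=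
  p.star_mul_self' x

lemma nonneg (p : CStarSeminorm R) (x : R) : 0 ≤ p x := apply_nonneg p.toSeminorm x

lemma le_star (p : CStarSeminorm R) (x : R) : p x ≤ p (star x) := by
  rcases (p.nonneg x).eq_or_lt with h | h
  · rw [← h]; exact p.nonneg _
  · have := p.mul_le (star x) x
    rw [star_mul_self] at this
    exact le_of_mul_le_mul_right this h

lemma star_eq (p : CStarSeminorm R) (x : R) : p (star x) = p x :=
  le_antisymm (by simpa using p.le_star (star x)) (p.le_star x)

lemma one_le (p : CStarSeminorm R) : p (1 : R) ≤ 1 := by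
  have h := p.star_mul_self (1 : R)
  rw [star_one, mul_one] at h
  by_contra! h'
  nlinarith

lemma le_one_of_star_mul_self (p : CStarSeminorm R) {x : R} (hx : star x * x = 1) : p x ≤ 1 := by
  have h := p.star_mul_self x
  rw [hx] at h
  have := p.one_le
  have := p.nonneg x
  by_contra! h'
  nlinarith

/-- The trivial `C⋆`-seminorm. -/
instance : Inhabited (CStarSeminorm R) := ⟨{
  toSeminorm := 0
  mul_le' := fun _ _ ↦ by change (0 : ℝ) ≤ 0 * 0; simp
  star_mul_self' := fun _ ↦ by change (0 : ℝ) = 0 * 0; simp }⟩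

/-- The pull-back of a `C⋆`-seminorm along a `⋆`-homomorphism. -/
def comp (p : CStarSeminorm S) (f : R →⋆ₐ[ℂ] S) : CStarSeminorm R where
  toSeminorm := p.toSeminorm.comp f.toAlgHom.toLinearMap
  mul_le' x y := by
    change p (f (x * y)) ≤ p (f x) * p (f y)
    rw [map_mul]; exact p.mul_le _ _
  star_mul_self' x := by
    change p (f (star x * x)) = p (f x) * p (f x)
    rw [map_mul, map_star]; exact p.star_mul_self _

lemma comp_apply (p : CStarSeminorm S) (f : R →⋆ₐ[ℂ] S) (x : R) : p.comp f x = p (f x) := rfl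

/-- The norm of a `C⋆`-algebra, as a `C⋆`-seminorm. -/
def ofNorm (D : Type*) [CStarAlgebra D] : CStarSeminorm D where
  toSeminorm := normSeminorm ℂ D
  mul_le' := norm_mul_le
  star_mul_self' _ := CStarRing.norm_star_mul_self

lemma ofNorm_apply {D : Type*} [CStarAlgebra D] (x : D) : ofNorm D x = ‖x‖ := rfl

/-- A `C⋆`-seminorm on a `C⋆`-algebra is dominated by the norm. -/
lemma le_norm {D : Type*} [CStarAlgebra D] (p : CStarSeminorm D) (x : D) : p x ≤ ‖x‖ := by
  let _ := CStarAlgebra.spectralOrder D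
  let _ := CStarAlgebra.spectralOrderedRing D
  -- self-adjoint contractions are averages of two unitaries
  have h1 : ∀ b : D, IsSelfAdjoint b → ‖b‖ ≤ 1 → p b ≤ 1 := by
    intro b hb hb1
    let u := selfAdjoint.unitarySelfAddISMul ⟨b, hb⟩ hb1
    have hu : b = (2⁻¹ : ℂ) • ((u : D) + star (u : D)) := by
      have h := selfAdjoint.realPart_unitarySelfAddISMul ⟨b, hb⟩ hb1
      have h' := congrArg (Subtype.val) h
      rw [realPart_apply_coe] at h'
      rw [← Complex.coe_smul] at h'
      simpa using h'.symm
    have hu1 : p (u : D) ≤ 1 := p.le_one_of_star_mul_self (Unitary.coe_star_mul_self u)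
    have hu2 : p (star (u : D)) ≤ 1 := by rw [star_eq]; exact hu1
    rw [hu]
    have e1 := map_smul_eq_mul p.toSeminorm (2⁻¹ : ℂ) ((u : D) + star (u : D))
    have e2 := map_add_le_add p.toSeminorm (u : D) (star (u : D))
    rw [norm_inv, Complex.norm_ofNat] at e1
    linarith
  have h2 : p (star x * x) ≤ ‖star x * x‖ := by
    rcases eq_or_ne (star x * x) 0 with h | h
    · rw [h, norm_zero]; exact (map_zero p.toSeminorm).le
    · have hn : 0 < ‖star x * x‖ := norm_pos_iff.mpr h
      have := h1 (((‖star x * x‖⁻¹ : ℝ) : ℂ) • (star x * x)) ?_ ?_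
      · rw [map_smul_eq_mul p.toSeminorm, Complex.norm_real, norm_inv, norm_norm,
          inv_mul_le_iff₀ hn, mul_one] at this
        exact this
      · rw [Complex.coe_smul]
        exact (IsSelfAdjoint.all _).smul (.star_mul_self x)
      · rw [norm_smul, Complex.norm_real, norm_inv, norm_norm, inv_mul_cancel₀ hn.ne']
  rw [star_mul_self, CStarRing.norm_star_mul_self] at h2
  exact abs_le_of_sq_le_sq' (by nlinarith) (norm_nonneg x) |>.2

end CStarSeminorm

/-- The group of integers (written multiplicatively), acting on `A` by the powers of `α`. -/
def IntAction {A : Type*} [CStarAlgebra A] (_α : A ≃⋆ₐ[ℂ] A) : Type := Multiplicative ℤ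

namespace IntAction

variable {A : Type*} [CStarAlgebra A] {α : A ≃⋆ₐ[ℂ] A}

instance : CommGroup (IntAction α) := inferInstanceAs (CommGroup (Multiplicative ℤ))

/-- The integer `n` as an element of the acting group. -/
def ofInt (α : A ≃⋆ₐ[ℂ] A) (n : ℤ) : IntAction α := Multiplicative.ofAdd n

/-- The integer underlying an element of the acting group. -/
def toInt (g : IntAction α) : ℤ := Multiplicative.toAdd g

@[simp] lemma toInt_one : toInt (1 : IntAction α) = 0 := rfl
@[simp] lemma toInt_mul (g h : IntAction α) : toInt (g * h) = toInt g + toInt h := rfl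
@[simp] lemma toInt_inv (g : IntAction α) : toInt g⁻¹ = - toInt g := rfl
@[simp] lemma toInt_ofInt (n : ℤ) : toInt (ofInt α n) = n := rfl
@[simp] lemma ofInt_toInt (g : IntAction α) : ofInt α (toInt g) = g := rfl

lemma ofInt_one_zpow (g : IntAction α) : ofInt α 1 ^ toInt g = g := by
  change (Multiplicative.ofAdd (1 : ℤ)) ^ (Multiplicative.toAdd g : ℤ) = g
  rw [← ofAdd_zsmul, smul_eq_mul, mul_one]; rfl

instance : MulSemiringAction (IntAction α) A where
  smul g a := (α ^ toInt g) a
  one_smul _ := rfl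
  mul_smul g h a := by
    change (α ^ toInt (g * h)) a = (α ^ toInt g) ((α ^ toInt h) a)
    rw [toInt_mul, zpow_add]; rfl
  smul_zero g := map_zero (α ^ toInt g)
  smul_add g := map_add (α ^ toInt g)
  smul_one g := map_one (α ^ toInt g)
  smul_mul g := map_mul (α ^ toInt g)

lemma smul_def (g : IntAction α) (a : A) : g • a = (α ^ toInt g) a := rfl

lemma smul_star (g : IntAction α) (a : A) : g • star a = star (g • a) :=
  map_star (α ^ toInt g) a

instance : SMulCommClass (IntAction α) ℂ A where
  smul_comm g c a := map_smul (α ^ toInt g) c a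

lemma norm_smul_eq (g : IntAction α) (a : A) : ‖g • a‖ = ‖a‖ :=
  StarAlgEquiv.norm_map (α ^ toInt g) a

end IntAction

/-- The `⋆`-algebra of finite sums `∑ aₙ Vⁿ` with `aₙ ∈ A`, where `V` is a unitary with
`V a V⋆ = α a`; the summand `a Vⁿ` is `SkewMonoidAlgebra.single n a`. -/
abbrev AlgCrossedProduct {A : Type*} [CStarAlgebra A] (α : A ≃⋆ₐ[ℂ] A) : Type _ :=
  SkewMonoidAlgebra A (IntAction α)

namespace AlgCrossedProduct

open SkewMonoidAlgebra IntAction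

variable {A : Type*} [CStarAlgebra A] {α : A ≃⋆ₐ[ℂ] A}

/-- The involution `(a Vⁿ)⋆ = V⁻ⁿ a⋆ = α⁻ⁿ(a⋆) V⁻ⁿ`, as an additive map. -/
def starAddHom (α : A ≃⋆ₐ[ℂ] A) : AlgCrossedProduct α →+ AlgCrossedProduct α :=
  (Finsupp.liftAddHom fun g : IntAction α ↦
    (singleAddHom g⁻¹).comp
      ((DistribSMul.toAddMonoidHom A g⁻¹).comp (starAddEquiv (R := A)).toAddMonoidHom)).comp
    coeffAddEquiv.toAddMonoidHom

instance : Star (AlgCrossedProduct α) := ⟨starAddHom α⟩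

@[simp] lemma star_single (g : IntAction α) (a : A) :
    star (single g a : AlgCrossedProduct α) = single g⁻¹ (g⁻¹ • star a) :=
  Finsupp.liftAddHom_apply_single _ _ _

lemma star_add' (x y : AlgCrossedProduct α) : star (x + y) = star x + star y :=
  map_add (starAddHom α) x y

lemma star_zero' : star (0 : AlgCrossedProduct α) = 0 := map_zero (starAddHom α)

instance : StarRing (AlgCrossedProduct α) where
  star_involutive x := by
    induction x using SkewMonoidAlgebra.induction_on' with
    | single g a => simp [← smul_star, smul_smul]
    | add x y hx hy => rw [star_add', star_add', hx, hy]
  star_mul x y := by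
    induction x using SkewMonoidAlgebra.induction_on' with
    | add x₁ x₂ h₁ h₂ => rw [add_mul, star_add', h₁, h₂, star_add', mul_add]
    | single g a =>
      induction y using SkewMonoidAlgebra.induction_on' with
      | add y₁ y₂ h₁ h₂ => rw [mul_add, star_add', h₁, h₂, star_add', add_mul]
      | single h b =>
        simp [single_mul_single, smul_mul', smul_smul, ← smul_star, mul_assoc, mul_comm g h,
          mul_comm g⁻¹ h⁻¹]
  star_add := star_add'

instance : StarModule ℂ (AlgCrossedProduct α) where
  star_smul c x := by
    induction x using SkewMonoidAlgebra.induction_on' with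
    | add x₁ x₂ h₁ h₂ => simp only [smul_add, star_add, h₁, h₂]
    | single g a => simp [SkewMonoidAlgebra.smul_single, smul_comm g⁻¹ _ (star a)]


lemma star_coeff (x : AlgCrossedProduct α) (g : IntAction α) :
    (star x).coeff g = g • star (x.coeff g⁻¹) := by
  classical
  induction x using SkewMonoidAlgebra.induction_on' with
  | add x y hx hy => simp [hx, hy]
  | single h a =>
    rw [star_single, coeff_single_apply, coeff_single_apply]
    by_cases hg : h⁻¹ = g
    · subst hg; simp
    · have : h ≠ g⁻¹ := fun h' ↦ hg (by simp [h'])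
      simp [hg, this]

lemma mul_mul_star_coeff_one (x y : AlgCrossedProduct α) (b : A) :
    (x * single 1 b * star y).coeff 1 =
      x.coeff.sum fun g a ↦ a * (g • b) * star (y.coeff g) := by
  rw [mul_assoc, coeff_mul_left, SkewMonoidAlgebra.sum_def]
  refine Finsupp.sum_congr fun g _ ↦ ?_
  simp [star_coeff, smul_mul', mul_assoc]

lemma mul_star_coeff_one (x y : AlgCrossedProduct α) :
    (x * star y).coeff 1 = x.coeff.sum fun g a ↦ a * star (y.coeff g) := by
  simpa [← SkewMonoidAlgebra.one_def] using mul_mul_star_coeff_one x y 1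

lemma single_mul_star_single (g : IntAction α) (a : A) :
    (single g a : AlgCrossedProduct α) * star (single g a) = single 1 (a * star a) := by
  simp

section Regular

attribute [local instance] CStarAlgebra.spectralOrder CStarAlgebra.spectralOrderedRing

lemma term_nonneg (a : A) : 0 ≤ a * star a := mul_star_self_nonneg a

/-- The algebraic crossed product, seen as the pre-Hilbert module `⨁ₙ A`. -/
def RegModule (α : A ≃⋆ₐ[ℂ] A) : Type _ := AlgCrossedProduct α

instance : AddCommGroup (RegModule α) := inferInstanceAs (AddCommGroup (AlgCrossedProduct α))
instance : Module ℂ (RegModule α) := inferInstanceAs (Module ℂ (AlgCrossedProduct α))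
instance : SMul A (RegModule α) := inferInstanceAs (SMul A (AlgCrossedProduct α))

/-- An element of the algebraic crossed product, seen in the pre-Hilbert module. -/
def toReg : AlgCrossedProduct α ≃ₗ[ℂ] RegModule α := LinearEquiv.refl ℂ _

instance : Norm (RegModule α) :=
  ⟨fun x ↦ √‖((toReg.symm x) * star (toReg.symm x)).coeff 1‖⟩

lemma self_mul_star_nonneg (x : AlgCrossedProduct α) : 0 ≤ (x * star x).coeff 1 := by
  rw [mul_star_coeff_one]
  exact Finset.sum_nonneg fun g _ ↦ mul_star_self_nonneg _

lemma coeff_mul_star_le (x : AlgCrossedProduct α) (g : IntAction α) :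
    x.coeff g * star (x.coeff g) ≤ (x * star x).coeff 1 := by
  rw [mul_star_coeff_one, Finsupp.sum]
  by_cases hg : g ∈ x.coeff.support
  · exact Finset.single_le_sum (f := fun g ↦ x.coeff g * star (x.coeff g))
      (fun g _ ↦ mul_star_self_nonneg _) hg
  · rw [Finsupp.notMem_support_iff.mp hg, zero_mul]
    exact Finset.sum_nonneg fun g _ ↦ mul_star_self_nonneg _

lemma sq_norm_coeff_le (x : AlgCrossedProduct α) (g : IntAction α) :
    ‖x.coeff g‖ ^ 2 ≤ ‖(x * star x).coeff 1‖ := by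
  rw [sq, ← CStarRing.norm_self_mul_star]
  exact CStarAlgebra.norm_le_norm_of_nonneg_of_le (mul_star_self_nonneg _) (coeff_mul_star_le x g)

instance : CStarModule A (RegModule α) where
  inner x y := (toReg.symm y * star (toReg.symm x)).coeff 1
  inner_add_right := by simp [add_mul]
  inner_self_nonneg := self_mul_star_nonneg _
  inner_self {x} := by
    constructor
    · intro h
      apply toReg.symm.injective
      rw [map_zero]
      ext g
      have := sq_norm_coeff_le (toReg.symm x) g
      rw [h, norm_zero] at this
      simpa using this
    · rintro rfl; simp
  inner_op_smul_right {a x y} := by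
    change ((a • toReg.symm y) * star (toReg.symm x)).coeff 1 = _
    rw [smul_mul_assoc, coeff_smul]; rfl
  inner_smul_right_complex := by simp
  star_inner x y := by
    have := star_coeff (toReg.symm y * star (toReg.symm x)) 1
    simpa using this.symm
  norm_eq_sqrt_norm_inner_self x := rfl

instance : NormedAddCommGroup (RegModule α) := CStarModule.normedAddCommGroup A
instance : NormedSpace ℂ (RegModule α) := .ofCore (CStarModule.normedSpaceCore A)

lemma reg_norm_sq (x : RegModule α) :
    ‖x‖ ^ 2 = ‖((toReg.symm x) * star (toReg.symm x)).coeff 1‖ :=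
  CStarModule.norm_sq_eq A

lemma reg_norm_mul_single_le (x : AlgCrossedProduct α) (g : IntAction α) (a : A) :
    ‖toReg (x * single g a)‖ ≤ ‖a‖ * ‖toReg x‖ := by
  refine abs_le_of_sq_le_sq' ?_ (by positivity) |>.2
  rw [mul_pow, reg_norm_sq, reg_norm_sq, LinearEquiv.symm_apply_apply,
    LinearEquiv.symm_apply_apply, star_mul, ← mul_assoc, mul_assoc x, single_mul_star_single,
    mul_mul_star_coeff_one]
  have h0 : ∀ h : IntAction α, 0 ≤ h • (a * star a) := fun h ↦ by
    rw [smul_mul', smul_star]; exact mul_star_self_nonneg _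
  have key : (x.coeff.sum fun h b ↦ b * (h • (a * star a)) * star (x.coeff h)) ≤
      (‖a‖ ^ 2) • (x * star x).coeff 1 := by
    rw [mul_star_coeff_one, Finsupp.sum, Finsupp.sum, Finset.smul_sum]
    refine Finset.sum_le_sum fun h _ ↦ ?_
    have := CStarAlgebra.star_right_conjugate_le_norm_smul (a := x.coeff h)
      (b := h • (a * star a)) (IsSelfAdjoint.of_nonneg (h0 h))
    rwa [norm_smul_eq, CStarRing.norm_self_mul_star, ← sq] at this
  refine (CStarAlgebra.norm_le_norm_of_nonneg_of_le ?_ key).trans ?_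
  · refine Finset.sum_nonneg fun h _ ↦ ?_
    exact star_right_conjugate_nonneg (h0 h) _
  · rw [norm_smul]; simp

lemma exists_reg_bound (x : AlgCrossedProduct α) :
    ∃ C : ℝ, ∀ y : RegModule α, ‖toReg (toReg.symm y * x)‖ ≤ C * ‖y‖ := by
  induction x using SkewMonoidAlgebra.induction_on' with
  | single g a => exact ⟨‖a‖, fun y ↦ reg_norm_mul_single_le (toReg.symm y) g a⟩
  | add x₁ x₂ h₁ h₂ =>
    obtain ⟨C₁, h₁⟩ := h₁
    obtain ⟨C₂, h₂⟩ := h₂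
    refine ⟨C₁ + C₂, fun y ↦ ?_⟩
    rw [mul_add, map_add, add_mul]
    exact (norm_add_le _ _).trans (add_le_add (h₁ y) (h₂ y))

/-- Right multiplication by `x`, as a bounded operator on the pre-Hilbert module. -/
def regOp (x : AlgCrossedProduct α) : RegModule α →L[ℂ] RegModule α :=
  LinearMap.mkContinuousOfExistsBound
    (toReg.toLinearMap ∘ₗ LinearMap.mulRight ℂ x ∘ₗ toReg.symm.toLinearMap) (exists_reg_bound x)

lemma regOp_apply (x : AlgCrossedProduct α) (y : RegModule α) :
    regOp x y = toReg (toReg.symm y * x) := rfl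

lemma regOp_adjoint_le (x : AlgCrossedProduct α) : ‖regOp x‖ ^ 2 ≤ ‖regOp (x * star x)‖ := by
  have h : ‖regOp x‖ ≤ √‖regOp (x * star x)‖ := by
    refine ContinuousLinearMap.opNorm_le_bound _ (Real.sqrt_nonneg _) fun y ↦ ?_
    refine abs_le_of_sq_le_sq' ?_ (by positivity) |>.2
    rw [mul_pow, Real.sq_sqrt (norm_nonneg _), reg_norm_sq, regOp_apply,
      LinearEquiv.symm_apply_apply, star_mul, ← mul_assoc, mul_assoc (toReg.symm y)]
    calc ‖(toReg.symm y * (x * star x) * star (toReg.symm y)).coeff 1‖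
        = ‖inner A y (regOp (x * star x) y)‖ := rfl
      _ ≤ ‖y‖ * ‖regOp (x * star x) y‖ := CStarModule.norm_inner_le _
      _ ≤ ‖y‖ * (‖regOp (x * star x)‖ * ‖y‖) := by
        gcongr; exact ContinuousLinearMap.le_opNorm _ _
      _ = ‖regOp (x * star x)‖ * ‖y‖ ^ 2 := by ring
  calc ‖regOp x‖ ^ 2 ≤ √‖regOp (x * star x)‖ ^ 2 := by gcongr
    _ = _ := Real.sq_sqrt (norm_nonneg _)

lemma regOp_mul_le (x y : AlgCrossedProduct α) : ‖regOp (x * y)‖ ≤ ‖regOp x‖ * ‖regOp y‖ := by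
  have : regOp (x * y) = regOp y ∘L regOp x := by
    ext z; simp [regOp_apply, mul_assoc]
  rw [this, mul_comm]
  exact ContinuousLinearMap.opNorm_comp_le _ _

lemma regOp_star_le (x : AlgCrossedProduct α) : ‖regOp x‖ ≤ ‖regOp (star x)‖ := by
  rcases (norm_nonneg (regOp x)).eq_or_lt with h | h
  · rw [← h]; exact norm_nonneg _
  · have := (regOp_adjoint_le x).trans (regOp_mul_le x (star x))
    rw [sq] at this
    exact le_of_mul_le_mul_left this h

/-- The `C⋆`-seminorm coming from the regular representation on the pre-Hilbert module
`⨁ₙ A`. -/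
def regSeminorm (α : A ≃⋆ₐ[ℂ] A) : CStarSeminorm (AlgCrossedProduct α) where
  toFun x := ‖regOp x‖
  map_zero' := by
    have : regOp (0 : AlgCrossedProduct α) = 0 := by ext z; simp [regOp_apply]
    rw [this, norm_zero]
  add_le' x y := by
    have : regOp (x + y) = regOp x + regOp y := by ext z; simp [regOp_apply, mul_add]
    rw [this]; exact norm_add_le _ _
  neg' x := by
    have : regOp (-x) = - regOp x := by ext z; simp [regOp_apply]
    rw [this, norm_neg]
  smul' c x := by
    have : regOp (c • x) = c • regOp x := by ext z; simp [regOp_apply]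
    rw [this, norm_smul]
  mul_le' := regOp_mul_le
  star_mul_self' x := by
    apply le_antisymm
    · refine (regOp_mul_le _ _).trans ?_
      gcongr
      simpa using regOp_star_le (star x)
    · have := regOp_adjoint_le (star x)
      rw [star_star] at this
      refine le_trans ?_ this
      rw [← sq]
      gcongr
      exact regOp_star_le x

lemma norm_coeff_le_regSeminorm (x : AlgCrossedProduct α) (g : IntAction α) :
    ‖x.coeff g‖ ≤ (regSeminorm α).toSeminorm x := by
  change ‖x.coeff g‖ ≤ ‖regOp x‖
  have h1 : ‖toReg (1 : AlgCrossedProduct α)‖ ≤ 1 := by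
    refine abs_le_of_sq_le_sq' ?_ zero_le_one |>.2
    rw [reg_norm_sq, LinearEquiv.symm_apply_apply, star_one, mul_one, coeff_one, Finsupp.single_eq_same, one_pow]
    rcases subsingleton_or_nontrivial A with h | h
    · simp [Subsingleton.elim (1 : A) 0]
    · rw [CStarRing.norm_one]
  calc ‖x.coeff g‖ ≤ ‖toReg x‖ := by
        refine abs_le_of_sq_le_sq' ?_ (norm_nonneg _) |>.2
        rw [reg_norm_sq]; exact sq_norm_coeff_le x g
    _ = ‖regOp x (toReg 1)‖ := by simp [regOp_apply]
    _ ≤ ‖regOp x‖ * ‖toReg (1 : AlgCrossedProduct α)‖ := ContinuousLinearMap.le_opNorm _ _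
    _ ≤ ‖regOp x‖ * 1 := by gcongr
    _ = ‖regOp x‖ := mul_one _

end Regular


/-- The embedding of `A` into the algebraic crossed product. -/
def of (α : A ≃⋆ₐ[ℂ] A) : A →⋆ₐ[ℂ] AlgCrossedProduct α where
  toFun a := single 1 a
  map_one' := rfl
  map_mul' a b := by simp
  map_zero' := single_zero 1
  map_add' := single_add 1
  commutes' _ := rfl
  map_star' a := by simp

lemma of_apply (a : A) : of α a = single 1 a := rfl

/-- The unitaries `Vⁿ` of the algebraic crossed product. -/
def unit (α : A ≃⋆ₐ[ℂ] A) : IntAction α →* unitary (AlgCrossedProduct α) where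
  toFun g := ⟨single g 1, by simp [Unitary.mem_iff]⟩
  map_one' := rfl
  map_mul' g h := Subtype.ext (by simp)

lemma of_mul_unit (g : IntAction α) (a : A) :
    of α a * (unit α g : AlgCrossedProduct α) = single g a := by
  simp [of_apply, unit]

lemma seminorm_single_le (p : CStarSeminorm (AlgCrossedProduct α)) (g : IntAction α) (a : A) :
    p (single g a) ≤ ‖a‖ := by
  rw [← of_mul_unit]
  calc p (of α a * unit α g) ≤ p (of α a) * p (unit α g : AlgCrossedProduct α) := p.mul_le _ _
    _ ≤ ‖a‖ * 1 := mul_le_mul ((p.comp (of α)).le_norm a)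
        (p.le_one_of_star_mul_self (Unitary.coe_star_mul_self (unit α g))) (p.nonneg _) (norm_nonneg a)
    _ = ‖a‖ := mul_one _

lemma bddAbove_seminorm (x : AlgCrossedProduct α) :
    BddAbove (Set.range fun p : CStarSeminorm (AlgCrossedProduct α) ↦ p x) := by
  induction x using SkewMonoidAlgebra.induction_on' with
  | single g a => exact ⟨‖a‖, by rintro _ ⟨p, rfl⟩; exact seminorm_single_le p g a⟩
  | add x y hx hy =>
    obtain ⟨C, hC⟩ := hx
    obtain ⟨D, hD⟩ := hy
    refine ⟨C + D, ?_⟩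
    rintro _ ⟨p, rfl⟩
    exact (map_add_le_add p.toSeminorm x y).trans (add_le_add (hC ⟨p, rfl⟩) (hD ⟨p, rfl⟩))

/-- The maximal `C⋆`-norm: the supremum of all `C⋆`-seminorms. -/
instance : Norm (AlgCrossedProduct α) :=
  ⟨fun x ↦ ⨆ p : CStarSeminorm (AlgCrossedProduct α), p x⟩

lemma norm_def (x : AlgCrossedProduct α) :
    ‖x‖ = ⨆ p : CStarSeminorm (AlgCrossedProduct α), p x := rfl

lemma seminorm_le (p : CStarSeminorm (AlgCrossedProduct α)) (x : AlgCrossedProduct α) :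
    p x ≤ ‖x‖ := le_ciSup (bddAbove_seminorm x) p

lemma norm_le_of_forall {x : AlgCrossedProduct α} {C : ℝ}
    (h : ∀ p : CStarSeminorm (AlgCrossedProduct α), p x ≤ C) : ‖x‖ ≤ C := ciSup_le h

lemma norm_nonneg' (x : AlgCrossedProduct α) : 0 ≤ ‖x‖ :=
  ((default : CStarSeminorm (AlgCrossedProduct α)).nonneg x).trans (seminorm_le _ x)

lemma norm_smul_le' (c : ℂ) (x : AlgCrossedProduct α) : ‖c • x‖ ≤ ‖c‖ * ‖x‖ :=
  norm_le_of_forall fun p ↦ by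
    rw [map_smul_eq_mul p.toSeminorm]
    exact mul_le_mul_of_nonneg_left (seminorm_le p x) (norm_nonneg c)

lemma norm_mul_le' (x y : AlgCrossedProduct α) : ‖x * y‖ ≤ ‖x‖ * ‖y‖ :=
  norm_le_of_forall fun p ↦ (p.mul_le x y).trans
    (mul_le_mul (seminorm_le p x) (seminorm_le p y) (p.nonneg y) (norm_nonneg' x))

lemma norm_coeff_le (x : AlgCrossedProduct α) (g : IntAction α) : ‖x.coeff g‖ ≤ ‖x‖ :=
  (norm_coeff_le_regSeminorm x g).trans (seminorm_le (regSeminorm α) x)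

instance : NormedAddCommGroup (AlgCrossedProduct α) :=
  AddGroupNorm.toNormedAddCommGroup
    { toFun := fun x ↦ ‖x‖
      map_zero' := le_antisymm
        (norm_le_of_forall fun p ↦ (map_zero p.toSeminorm).le) (norm_nonneg' 0)
      add_le' := fun x y ↦ norm_le_of_forall fun p ↦
        (map_add_le_add p.toSeminorm x y).trans (add_le_add (seminorm_le p x) (seminorm_le p y))
      neg' := fun x ↦ by
        simp only [norm_def]
        exact iSup_congr fun p ↦ map_neg_eq_map p.toSeminorm x
      eq_zero_of_map_eq_zero' := fun x hx ↦ by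
        ext g
        have := norm_coeff_le x g
        rw [hx] at this
        simpa using this }

instance : NormedRing (AlgCrossedProduct α) where
  __ := (inferInstance : NormedAddCommGroup (AlgCrossedProduct α))
  __ := (inferInstance : Ring (AlgCrossedProduct α))
  norm_mul_le := norm_mul_le'

instance : NormedAlgebra ℂ (AlgCrossedProduct α) where
  norm_smul_le := norm_smul_le'

instance : CStarRing (AlgCrossedProduct α) where
  norm_mul_self_le x := by
    have h : ‖x‖ ≤ √‖star x * x‖ := norm_le_of_forall fun p ↦
      Real.le_sqrt_of_sq_le (by
        rw [sq, ← p.star_mul_self]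
        exact seminorm_le p _)
    calc ‖x‖ * ‖x‖ ≤ √‖star x * x‖ * √‖star x * x‖ := by gcongr
      _ = ‖star x * x‖ := Real.mul_self_sqrt (norm_nonneg _)

end AlgCrossedProduct

/-- The `C⋆`-crossed product `A ⋊_α ℤ`: the completion of the `⋆`-algebra of finite sums
`∑ aₙ Vⁿ` with respect to its maximal `C⋆`-norm. -/
def IntCrossedProduct {A : Type*} [CStarAlgebra A] (α : A ≃⋆ₐ[ℂ] A) : Type _ :=
  Completion (AlgCrossedProduct α)

namespace IntCrossedProduct

open SkewMonoidAlgebra IntAction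

variable {A : Type*} [CStarAlgebra A] {α : A ≃⋆ₐ[ℂ] A}

instance : NormedRing (IntCrossedProduct α) :=
  inferInstanceAs (NormedRing (Completion (AlgCrossedProduct α)))
instance : CompleteSpace (IntCrossedProduct α) :=
  inferInstanceAs (CompleteSpace (Completion (AlgCrossedProduct α)))
instance : Algebra ℂ (IntCrossedProduct α) :=
  inferInstanceAs (Algebra ℂ (Completion (AlgCrossedProduct α)))

/-- The map from the algebraic crossed product to its completion. -/
def mk (x : AlgCrossedProduct α) : IntCrossedProduct α := (x : Completion (AlgCrossedProduct α))

lemma mk_add (x y : AlgCrossedProduct α) : mk (x + y) = mk x + mk y := Completion.coe_add x y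
lemma mk_mul (x y : AlgCrossedProduct α) : mk (x * y) = mk x * mk y := Completion.coe_mul x y
lemma mk_smul (c : ℂ) (x : AlgCrossedProduct α) : mk (c • x) = c • mk x :=
  Completion.coe_smul c x
lemma norm_mk (x : AlgCrossedProduct α) : ‖mk x‖ = ‖x‖ := Completion.norm_coe x
lemma continuous_mk : Continuous (mk : AlgCrossedProduct α → IntCrossedProduct α) :=
  Completion.continuous_coe _
lemma denseRange_mk : DenseRange (mk : AlgCrossedProduct α → IntCrossedProduct α) :=
  Completion.denseRange_coe

instance : NormedAlgebra ℂ (IntCrossedProduct α) where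
  norm_smul_le c x := (norm_smul_le c (show Completion (AlgCrossedProduct α) from x))

instance : Star (IntCrossedProduct α) :=
  ⟨(Completion.map star : Completion (AlgCrossedProduct α) → Completion (AlgCrossedProduct α))⟩

lemma star_mk (x : AlgCrossedProduct α) : star (mk x) = mk (star x) :=
  Completion.map_coe (star_isometry.uniformContinuous) x

lemma continuous_star' : Continuous (star : IntCrossedProduct α → IntCrossedProduct α) :=
  Completion.continuous_map

instance : StarRing (IntCrossedProduct α) where
  star_involutive x := by
    refine denseRange_mk.induction_on x
      (isClosed_eq (continuous_star'.comp continuous_star') continuous_id) fun a ↦ ?_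
    rw [star_mk, star_mk, star_star]
  star_mul x y := by
    refine denseRange_mk.induction_on₂ (p := fun x y ↦ star (x * y) = star y * star x)
      (isClosed_eq (continuous_star'.comp continuous_mul)
        ((continuous_star'.comp continuous_snd).mul (continuous_star'.comp continuous_fst)))
      (fun a b ↦ ?_) x y
    rw [← mk_mul, star_mk, star_mk, star_mk, ← mk_mul, star_mul]
  star_add x y := by
    refine denseRange_mk.induction_on₂ (p := fun x y ↦ star (x + y) = star x + star y)
      (isClosed_eq (continuous_star'.comp continuous_add)
        ((continuous_star'.comp continuous_fst).add (continuous_star'.comp continuous_snd)))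
      (fun a b ↦ ?_) x y
    rw [← mk_add, star_mk, star_mk, star_mk, ← mk_add, star_add]

instance : CStarAlgebra (IntCrossedProduct α) where
  norm_mul_self_le x := by
    refine denseRange_mk.induction_on x
      (isClosed_le (continuous_norm.mul continuous_norm)
        (continuous_norm.comp (continuous_star'.mul continuous_id))) fun a ↦ ?_
    change ‖mk a‖ * ‖mk a‖ ≤ ‖star (mk a) * mk a‖
    rw [star_mk, ← mk_mul, norm_mk, norm_mk]
    exact CStarRing.norm_mul_self_le a
  star_smul c x := by
    refine denseRange_mk.induction_on x
      (isClosed_eq (continuous_star'.comp (continuous_const_smul c))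
        (continuous_star'.const_smul (star c))) fun a ↦ ?_
    rw [← mk_smul, star_mk, star_mk, ← mk_smul, star_smul]

/-- The map from the algebraic crossed product to its completion, as a `⋆`-homomorphism. -/
def mkHom (α : A ≃⋆ₐ[ℂ] A) : AlgCrossedProduct α →⋆ₐ[ℂ] IntCrossedProduct α where
  toFun := mk
  map_one' := rfl
  map_mul' := mk_mul
  map_zero' := rfl
  map_add' := mk_add
  commutes' _ := rfl
  map_star' x := (star_mk x).symm

/-- The canonical unital embedding of `A` into the crossed product. -/
def ι (α : A ≃⋆ₐ[ℂ] A) : A →⋆ₐ[ℂ] IntCrossedProduct α := (mkHom α).comp (AlgCrossedProduct.of α)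

/-- The implementing unitary `V` of the crossed product, with `V a V⋆ = α a`. -/
def V (α : A ≃⋆ₐ[ℂ] A) : unitary (IntCrossedProduct α) :=
  Unitary.map (StarMonoidHom.ofClass (mkHom α))
    (AlgCrossedProduct.unit α (ofInt α 1))

lemma V_mul_ι (a : A) : (V α : IntCrossedProduct α) * ι α a = ι α (α a) * V α := by
  change mkHom α (single (ofInt α 1) 1) * mkHom α (single 1 a) =
    mkHom α (single 1 (α a)) * mkHom α (single (ofInt α 1) 1)
  rw [← map_mul, ← map_mul, single_mul_single, single_mul_single, IntAction.smul_def]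
  simp

lemma ι_mul_V_zpow (a : A) (g : IntAction α) :
    ι α a * ((V α ^ toInt g : unitary (IntCrossedProduct α)) : IntCrossedProduct α) =
      mk (single g a) := by
  have h : AlgCrossedProduct.unit α (ofInt α 1) ^ toInt g = AlgCrossedProduct.unit α g := by
    rw [← map_zpow, ofInt_one_zpow]
  rw [V, ← map_zpow, h, ← AlgCrossedProduct.of_mul_unit, mk_mul]
  rfl

section Lift

variable {D : Type*} [CStarAlgebra D]

lemma covariant_zpow {f : A →⋆ₐ[ℂ] D} {v : unitary D} (h : ∀ a, v * f a = f (α a) * v)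
    (n : ℤ) (a : A) :
    f ((α ^ n) a) * ((v ^ n : unitary D) : D) = ((v ^ n : unitary D) : D) * f a := by
  induction n generalizing a with
  | zero => simp
  | succ n ih =>
    rw [zpow_add_one, zpow_add_one, Submonoid.coe_mul, StarAlgEquiv.mul_apply, ← mul_assoc, ih,
      mul_assoc, ← h, mul_assoc]
  | pred n ih =>
    have h' : f (α⁻¹ a) * ((v⁻¹ : unitary D) : D) = ((v⁻¹ : unitary D) : D) * f a := by
      have h1 := h (α⁻¹ a)
      rw [← StarAlgEquiv.mul_apply, mul_inv_cancel, StarAlgEquiv.one_apply] at h1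
      calc f (α⁻¹ a) * ((v⁻¹ : unitary D) : D)
          = ((v⁻¹ * v : unitary D) : D) * f (α⁻¹ a) * ((v⁻¹ : unitary D) : D) := by simp
        _ = ((v⁻¹ : unitary D) : D) * (v * f (α⁻¹ a)) * ((v⁻¹ : unitary D) : D) := by
          rw [Submonoid.coe_mul, mul_assoc ((v⁻¹ : unitary D) : D)]
        _ = ((v⁻¹ : unitary D) : D) * f a * ((v * v⁻¹ : unitary D) : D) := by
          rw [h1, Submonoid.coe_mul]; simp only [mul_assoc]
        _ = _ := by simp
    rw [zpow_sub_one, zpow_sub_one, Submonoid.coe_mul, StarAlgEquiv.mul_apply, ← mul_assoc, ih,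
      mul_assoc, h', mul_assoc]

/-- The `⋆`-homomorphism `∑ aₙ Vⁿ ↦ ∑ f(aₙ) vⁿ` given by a covariant pair `(f, v)`. -/
def liftAlg (f : A →⋆ₐ[ℂ] D) (v : unitary D) (h : ∀ a, v * f a = f (α a) * v) :
    AlgCrossedProduct α →⋆ₐ[ℂ] D where
  __ := liftNCAlgHom (G := IntAction α) f.toAlgHom
    { toFun := fun g ↦ ((v ^ toInt g : unitary D) : D)
      map_one' := by simp
      map_mul' := fun g g' ↦ by simp [zpow_add] }
    (fun {a g} ↦ covariant_zpow h (toInt g) a)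
  map_star' x := by
    have hs : ∀ (g : IntAction α) (a : A), (liftNCAlgHom (G := IntAction α) f.toAlgHom
        { toFun := fun g ↦ ((v ^ toInt g : unitary D) : D)
          map_one' := by simp
          map_mul' := fun g g' ↦ by simp [zpow_add] }
        (fun {a g} ↦ covariant_zpow h (toInt g) a)) (single g a) =
          f a * ((v ^ toInt g : unitary D) : D) := fun g a ↦ liftNC_single _ _ _ _
    induction x using SkewMonoidAlgebra.induction_on' with
    | add x y hx hy =>
      simp only [AlgHom.toRingHom_eq_coe, RingHom.toMonoidHom_eq_coe, OneHom.toFun_eq_coe,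
        MonoidHom.toOneHom_coe, MonoidHom.coe_coe, RingHom.coe_coe] at hx hy ⊢
      rw [star_add, map_add, hx, hy, map_add, star_add]
    | single g a =>
      simp only [AlgHom.toRingHom_eq_coe, RingHom.toMonoidHom_eq_coe, OneHom.toFun_eq_coe,
        MonoidHom.toOneHom_coe, MonoidHom.coe_coe, RingHom.coe_coe]
      rw [AlgCrossedProduct.star_single, hs, hs, IntAction.smul_def, covariant_zpow h, star_mul,
        toInt_inv, zpow_neg, ← Unitary.coe_star, Unitary.star_eq_inv, map_star]

lemma liftAlg_single (f : A →⋆ₐ[ℂ] D) (v : unitary D) (h : ∀ a, v * f a = f (α a) * v)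
    (g : IntAction α) (a : A) :
    liftAlg f v h (single g a) = f a * ((v ^ toInt g : unitary D) : D) := liftNC_single _ _ _ _

lemma norm_liftAlg_le (f : A →⋆ₐ[ℂ] D) (v : unitary D) (h : ∀ a, v * f a = f (α a) * v)
    (x : AlgCrossedProduct α) : ‖liftAlg f v h x‖ ≤ ‖x‖ :=
  AlgCrossedProduct.seminorm_le ((CStarSeminorm.ofNorm D).comp (liftAlg f v h)) x

/-- The extension of `liftAlg` to the crossed product, as a continuous linear map. -/
def liftCLM (f : A →⋆ₐ[ℂ] D) (v : unitary D) (h : ∀ a, v * f a = f (α a) * v) :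
    IntCrossedProduct α →L[ℂ] D :=
  ((liftAlg f v h).toAlgHom.toLinearMap.mkContinuous 1
    fun x ↦ by rw [one_mul]; exact norm_liftAlg_le f v h x).fromCompletion

lemma liftCLM_mk (f : A →⋆ₐ[ℂ] D) (v : unitary D) (h : ∀ a, v * f a = f (α a) * v)
    (x : AlgCrossedProduct α) : liftCLM f v h (mk x) = liftAlg f v h x :=
  ContinuousLinearMap.fromCompletion_apply_coe _ x

/-- The universal property of the crossed product: a covariant pair `(f, v)` in a unital
`C⋆`-algebra `D` induces a unital `⋆`-homomorphism `A ⋊_α ℤ → D` with `a ↦ f a`, `V ↦ v`. -/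
def lift (f : A →⋆ₐ[ℂ] D) (v : unitary D) (h : ∀ a, v * f a = f (α a) * v) :
    IntCrossedProduct α →⋆ₐ[ℂ] D where
  __ := AlgHom.ofLinearMap (liftCLM f v h).toLinearMap
    (by
      change liftCLM f v h (mk 1) = 1
      rw [liftCLM_mk, map_one])
    (fun x y ↦ by
      change liftCLM f v h (x * y) = liftCLM f v h x * liftCLM f v h y
      refine denseRange_mk.induction_on₂
        (p := fun x y ↦ liftCLM f v h (x * y) = liftCLM f v h x * liftCLM f v h y)
        (isClosed_eq (by fun_prop) (by fun_prop)) (fun a b ↦ ?_) x y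
      rw [← mk_mul, liftCLM_mk, liftCLM_mk, liftCLM_mk, map_mul])
  map_star' x := by
    change liftCLM f v h (star x) = star (liftCLM f v h x)
    refine denseRange_mk.induction_on x (isClosed_eq (by fun_prop) (by fun_prop)) fun a ↦ ?_
    rw [star_mk, liftCLM_mk, liftCLM_mk, map_star]

lemma lift_mk_single (f : A →⋆ₐ[ℂ] D) (v : unitary D) (h : ∀ a, v * f a = f (α a) * v)
    (g : IntAction α) (a : A) :
    lift f v h (mk (single g a)) = f a * ((v ^ toInt g : unitary D) : D) := by
  change liftCLM f v h (mk (single g a)) = _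
  rw [liftCLM_mk, liftAlg_single]

@[simp] lemma lift_ι (f : A →⋆ₐ[ℂ] D) (v : unitary D) (h : ∀ a, v * f a = f (α a) * v) (a : A) :
    lift f v h (ι α a) = f a := by
  change lift f v h (mk (single 1 a)) = _
  rw [lift_mk_single]; simp

@[simp] lemma lift_V (f : A →⋆ₐ[ℂ] D) (v : unitary D) (h : ∀ a, v * f a = f (α a) * v) :
    lift f v h (V α : IntCrossedProduct α) = v := by
  change lift f v h (mk (single (ofInt α 1) 1)) = _
  rw [lift_mk_single]; simp

/-- A `⋆`-homomorphism on the crossed product is determined by its values on `A` and `V`. -/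
lemma hom_ext {φ ψ : IntCrossedProduct α →⋆ₐ[ℂ] D} (h₁ : ∀ a, φ (ι α a) = ψ (ι α a))
    (h₂ : φ (V α : IntCrossedProduct α) = ψ (V α : IntCrossedProduct α)) : φ = ψ := by
  have hV : ∀ n : ℤ, φ ((V α ^ n : unitary (IntCrossedProduct α)) : IntCrossedProduct α) =
      ψ ((V α ^ n : unitary (IntCrossedProduct α)) : IntCrossedProduct α) := fun n ↦ by
    have h : Unitary.map (StarMonoidHom.ofClass φ) (V α) =
        Unitary.map (StarMonoidHom.ofClass ψ) (V α) := Subtype.ext h₂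
    have h' := congrArg (fun w : unitary D ↦ ((w ^ n : unitary D) : D)) h
    simp only [← map_zpow] at h'
    exact h'
  have hφ : Continuous φ := map_continuous φ
  have hψ : Continuous ψ := map_continuous ψ
  ext x
  refine denseRange_mk.induction_on x (isClosed_eq hφ hψ) fun a ↦ ?_
  induction a using SkewMonoidAlgebra.induction_on' with
  | add x y hx hy => rw [mk_add, map_add, map_add, hx, hy]
  | single g a => rw [← ι_mul_V_zpow, map_mul, map_mul, h₁, hV]

end Lift

section SkewProduct

/-- The `⋆`-endomorphism of the crossed product with `a ↦ θ a` and `V ↦ u V`. -/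
def skewHom (α θ : A ≃⋆ₐ[ℂ] A) (u : unitary A)
    (hu : ∀ a, (u : A) * α (θ a) = θ (α a) * u) :
    IntCrossedProduct α →⋆ₐ[ℂ] IntCrossedProduct α :=
  lift ((ι α).comp (θ : A →⋆ₐ[ℂ] A))
    (Unitary.map (StarMonoidHom.ofClass (ι α)) u * V α) fun a ↦ by
      change ι α u * (V α : IntCrossedProduct α) * ι α (θ a) =
        ι α (θ (α a)) * (ι α u * (V α : IntCrossedProduct α))
      rw [mul_assoc, V_mul_ι, ← mul_assoc, ← mul_assoc, ← map_mul, ← map_mul, hu]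

@[simp] lemma skewHom_ι (θ : A ≃⋆ₐ[ℂ] A) (u : unitary A)
    (hu : ∀ a, (u : A) * α (θ a) = θ (α a) * u) (a : A) :
    skewHom α θ u hu (ι α a) = ι α (θ a) := lift_ι ..

@[simp] lemma skewHom_V (θ : A ≃⋆ₐ[ℂ] A) (u : unitary A)
    (hu : ∀ a, (u : A) * α (θ a) = θ (α a) * u) :
    skewHom α θ u hu (V α : IntCrossedProduct α) = ι α u * (V α : IntCrossedProduct α) := lift_V ..

lemma intertwine_symm {θ : A ≃⋆ₐ[ℂ] A} {u : unitary A}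
    (hu : ∀ a, (u : A) * α (θ a) = θ (α a) * u) (a : A) :
    ((Unitary.map (StarMonoidHom.ofClass θ.symm) (star u) : unitary A) : A) * α (θ.symm a) =
      θ.symm (α a) * (Unitary.map (StarMonoidHom.ofClass θ.symm) (star u) : unitary A) := by
  change θ.symm (star (u : A)) * α (θ.symm a) = θ.symm (α a) * θ.symm (star (u : A))
  apply θ.injective
  have h := hu (θ.symm a)
  rw [StarAlgEquiv.apply_symm_apply] at h
  change θ (_ * _) = θ (_ * _)
  rw [map_mul, map_mul, StarAlgEquiv.apply_symm_apply, StarAlgEquiv.apply_symm_apply]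
  calc star (u : A) * θ (α (θ.symm a))
      = star (u : A) * (θ (α (θ.symm a)) * u) * star (u : A) := by
        rw [mul_assoc, mul_assoc, Unitary.mul_star_self_of_mem u.2, mul_one]
    _ = star (u : A) * u * α a * star (u : A) := by rw [← h]; simp only [mul_assoc]
    _ = α a * star (u : A) := by rw [Unitary.star_mul_self_of_mem u.2, one_mul]

/-- The skew-product automorphism `Φ_{θ,u}` of the crossed product, determined by `a ↦ θ a` and
`V ↦ u V`, where the unitary `u ∈ A` intertwines `α ∘ θ` and `θ ∘ α`. -/
def skewProduct (α θ : A ≃⋆ₐ[ℂ] A) (u : unitary A)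
    (hu : ∀ a, (u : A) * α (θ a) = θ (α a) * u) :
    IntCrossedProduct α ≃⋆ₐ[ℂ] IntCrossedProduct α :=
  StarAlgEquiv.ofStarAlgHom (skewHom α θ u hu)
    (skewHom α θ.symm (Unitary.map (StarMonoidHom.ofClass θ.symm) (star u)) (intertwine_symm hu))
    (hom_ext (fun a ↦ by simp) (by
      change skewHom α θ.symm _ (intertwine_symm hu) (skewHom α θ u hu (V α : IntCrossedProduct α)) =
        (V α : IntCrossedProduct α)
      rw [skewHom_V, map_mul, skewHom_ι, skewHom_V]
      change ι α (θ.symm (u : A)) * (ι α (θ.symm (star (u : A))) * (V α : IntCrossedProduct α)) = _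
      rw [← mul_assoc, ← map_mul, ← map_mul]; simp))
    (hom_ext (fun a ↦ by simp) (by
      change skewHom α θ u hu (skewHom α θ.symm _ (intertwine_symm hu) (V α : IntCrossedProduct α)) =
        (V α : IntCrossedProduct α)
      rw [skewHom_V, map_mul, skewHom_ι, skewHom_V]
      change ι α (θ (θ.symm (star (u : A)))) * (ι α (u : A) * (V α : IntCrossedProduct α)) = _
      rw [StarAlgEquiv.apply_symm_apply, ← mul_assoc, ← map_mul]; simp))

lemma skewProduct_ι (θ : A ≃⋆ₐ[ℂ] A) (u : unitary A)
    (hu : ∀ a, (u : A) * α (θ a) = θ (α a) * u) (a : A) :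
    skewProduct α θ u hu (ι α a) = ι α (θ a) := skewHom_ι θ u hu a

lemma skewProduct_V (θ : A ≃⋆ₐ[ℂ] A) (u : unitary A)
    (hu : ∀ a, (u : A) * α (θ a) = θ (α a) * u) :
    skewProduct α θ u hu (V α : IntCrossedProduct α) = ι α u * (V α : IntCrossedProduct α) :=
  skewHom_V θ u hu

end SkewProduct

section Gauge

/-- The scalar unitaries of the crossed product. -/
def scalar (α : A ≃⋆ₐ[ℂ] A) : Circle →* unitary (IntCrossedProduct α) where
  toFun z := ⟨algebraMap ℂ (IntCrossedProduct α) z, by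
    have h1 : (z : ℂ) * star (z : ℂ) = 1 := by
      rw [Complex.star_def, Complex.mul_conj, Circle.normSq_coe, Complex.ofReal_one]
    rw [Unitary.mem_iff, ← algebraMap_star_comm, ← map_mul, ← map_mul, mul_comm (star (z : ℂ)), h1,
      map_one]
    exact ⟨rfl, rfl⟩⟩
  map_one' := Subtype.ext (by simp)
  map_mul' z w := Subtype.ext (by simp)

/-- The unitary `z V`, for `z` in the circle. -/
def circleV (α : A ≃⋆ₐ[ℂ] A) (z : Circle) : unitary (IntCrossedProduct α) := scalar α z * V α

lemma circleV_zpow (z : Circle) (n : ℤ) :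
    ((circleV α z ^ n : unitary (IntCrossedProduct α)) : IntCrossedProduct α) =
      (z : ℂ) ^ n • ((V α ^ n : unitary (IntCrossedProduct α)) : IntCrossedProduct α) := by
  have hc : Commute (scalar α z) (V α) :=
    Subtype.ext (Algebra.commutes (z : ℂ) (V α : IntCrossedProduct α))
  rw [circleV, hc.mul_zpow, ← map_zpow, Submonoid.coe_mul]
  change algebraMap ℂ (IntCrossedProduct α) ((z ^ n : Circle) : ℂ) * _ = _
  rw [Circle.coe_zpow, ← Algebra.smul_def]

lemma coe_circleV (z : Circle) :
    (circleV α z : IntCrossedProduct α) = (z : ℂ) • (V α : IntCrossedProduct α) := by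
  simpa using circleV_zpow (α := α) z 1

/-- The gauge action `ρ_z` of the circle, determined by `a ↦ a` and `V ↦ z V`. -/
def gauge (α : A ≃⋆ₐ[ℂ] A) (z : Circle) : IntCrossedProduct α →⋆ₐ[ℂ] IntCrossedProduct α :=
  lift (ι α) (circleV α z) fun a ↦ by
    rw [coe_circleV, smul_mul_assoc, mul_smul_comm, V_mul_ι]

lemma gauge_ι (z : Circle) (a : A) : gauge α z (ι α a) = ι α a := lift_ι ..

lemma gauge_V (z : Circle) :
    gauge α z (V α : IntCrossedProduct α) = (z : ℂ) • (V α : IntCrossedProduct α) :=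
  (lift_V ..).trans (coe_circleV z)

lemma gauge_mk_single (z : Circle) (g : IntAction α) (a : A) :
    gauge α z (mk (single g a)) = (z : ℂ) ^ toInt g • mk (single g a) := by
  rw [gauge, lift_mk_single, circleV_zpow, mul_smul_comm, ι_mul_V_zpow]

lemma norm_gauge_le (z : Circle) (x : IntCrossedProduct α) : ‖gauge α z x‖ ≤ ‖x‖ :=
  NonUnitalStarAlgHom.norm_apply_le (gauge α z) x

lemma continuous_gauge (x : IntCrossedProduct α) : Continuous fun z ↦ gauge α z x := by
  have h : ∀ a : AlgCrossedProduct α, Continuous fun z ↦ gauge α z (mk a) := fun a ↦ by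
    induction a using SkewMonoidAlgebra.induction_on' with
    | add x y hx hy => simp only [mk_add, map_add]; exact hx.add hy
    | single g a =>
      simp only [gauge_mk_single, ← Circle.coe_zpow]
      have hz : Continuous fun z : Circle ↦ ((z ^ toInt g : Circle) : ℂ) := by
        simp only [Circle.coe_zpow]
        exact Continuous.zpow₀ (by fun_prop) _ fun z ↦ Or.inl (Circle.coe_ne_zero z)
      exact hz.smul continuous_const
  refine continuous_of_uniform_approx_of_continuous fun s hs ↦ ?_
  obtain ⟨ε, hε, hs⟩ := Metric.mem_uniformity_dist.mp hs
  obtain ⟨a, ha⟩ := denseRange_mk.exists_dist_lt x hε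
  refine ⟨_, h a, fun z ↦ hs ?_⟩
  rw [dist_eq_norm] at ha ⊢
  rw [← map_sub]
  exact (norm_gauge_le z _).trans_lt ha

/-- The average `∮ ρ_z(x) dz / (2πiz)` of `x` over the gauge action, in the parametrisation
`z = exp(it)`. -/
def gaugeAverage (x : IntCrossedProduct α) : IntCrossedProduct α :=
  (2 * Real.pi)⁻¹ • ∫ t in (0 : ℝ)..(2 * Real.pi), gauge α (Circle.exp t) x

/-- The conditional expectation `E : A ⋊_α ℤ → A`: the continuous extension of
`∑ aₙ Vⁿ ↦ a₀`. It is the average over the gauge action, see `ι_condExp`. -/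
def condExp (α : A ≃⋆ₐ[ℂ] A) : IntCrossedProduct α →L[ℂ] A :=
  (LinearMap.mkContinuous
    ({ toFun := fun x ↦ x.coeff 1
       map_add' := fun x y ↦ by simp
       map_smul' := fun c x ↦ by simp } : AlgCrossedProduct α →ₗ[ℂ] A) 1
    fun x ↦ by rw [one_mul]; exact AlgCrossedProduct.norm_coeff_le x 1).fromCompletion

lemma condExp_mk (x : AlgCrossedProduct α) : condExp α (mk x) = x.coeff 1 :=
  ContinuousLinearMap.fromCompletion_apply_coe _ x

lemma condExp_ι (a : A) : condExp α (ι α a) = a := by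
  change condExp α (mk (single 1 a)) = a
  rw [condExp_mk, coeff_single, Finsupp.single_eq_same]

lemma continuous_gauge_exp (x : IntCrossedProduct α) :
    Continuous fun t : ℝ ↦ gauge α (Circle.exp t) x :=
  (continuous_gauge x).comp Circle.exp.continuous

lemma gaugeAverage_add (x y : IntCrossedProduct α) :
    gaugeAverage (x + y) = gaugeAverage x + gaugeAverage y := by
  simp only [gaugeAverage, map_add]
  rw [intervalIntegral.integral_add ((continuous_gauge_exp x).intervalIntegrable _ _)
    ((continuous_gauge_exp y).intervalIntegrable _ _), smul_add]

lemma gaugeAverage_neg (x : IntCrossedProduct α) : gaugeAverage (-x) = -gaugeAverage x := by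
  simp only [gaugeAverage, map_neg]
  rw [intervalIntegral.integral_neg, smul_neg]

lemma norm_gaugeAverage_le (x : IntCrossedProduct α) : ‖gaugeAverage x‖ ≤ ‖x‖ := by
  have h := intervalIntegral.norm_integral_le_of_norm_le_const (a := 0) (b := 2 * Real.pi)
    (f := fun t : ℝ ↦ gauge α (Circle.exp t) x) (C := ‖x‖) fun t _ ↦ norm_gauge_le _ x
  have hp : 0 < 2 * Real.pi := by positivity
  rw [sub_zero, abs_of_pos hp] at h
  rw [gaugeAverage, norm_smul, norm_inv, Real.norm_of_nonneg hp.le, inv_mul_le_iff₀ hp]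
  linarith

lemma continuous_gaugeAverage :
    Continuous (gaugeAverage : IntCrossedProduct α → IntCrossedProduct α) := by
  refine (LipschitzWith.of_dist_le_mul (K := 1) fun x y ↦ ?_).continuous
  rw [dist_eq_norm, dist_eq_norm, NNReal.coe_one, one_mul, sub_eq_add_neg, ← gaugeAverage_neg,
    ← gaugeAverage_add, ← sub_eq_add_neg]
  exact norm_gaugeAverage_le _

lemma gaugeAverage_mk_single (g : IntAction α) (a : A) :
    gaugeAverage (mk (single g a)) = ι α ((single g a : AlgCrossedProduct α).coeff 1) := by
  have hp : (2 * Real.pi) ≠ 0 := by positivity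
  by_cases hg : g = 1
  · subst hg
    simp only [gaugeAverage, gauge_mk_single, toInt_one, zpow_zero, one_smul]
    rw [intervalIntegral.integral_const, sub_zero, smul_smul, inv_mul_cancel₀ hp, one_smul,
      coeff_single, Finsupp.single_eq_same]
    rfl
  · have hn : toInt g ≠ 0 := fun h ↦ hg h
    have hc : (toInt g : ℂ) * Complex.I ≠ 0 :=
      mul_ne_zero (Int.cast_ne_zero.mpr hn) Complex.I_ne_zero
    have hi : ∫ t in (0 : ℝ)..(2 * Real.pi), ((Circle.exp t : Circle) : ℂ) ^ toInt g = 0 := by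
      have : ∀ t : ℝ, ((Circle.exp t : Circle) : ℂ) ^ toInt g =
          Complex.exp ((toInt g : ℂ) * Complex.I * t) := fun t ↦ by
        rw [Circle.coe_exp, ← Complex.exp_int_mul]; congr 1; ring
      simp only [this]
      rw [integral_exp_mul_complex hc]
      have h2 : (toInt g : ℂ) * Complex.I * ((2 * Real.pi : ℝ) : ℂ) =
          toInt g * (2 * Real.pi * Complex.I) := by push_cast; ring
      rw [h2, Complex.exp_int_mul_two_pi_mul_I]
      simp
    simp only [gaugeAverage, gauge_mk_single]
    rw [intervalIntegral.integral_smul_const, hi, zero_smul, smul_zero, coeff_single,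
      Finsupp.single_eq_of_ne (Ne.symm hg), map_zero]

/-- The conditional expectation is the average over the gauge action. -/
theorem ι_condExp (x : IntCrossedProduct α) : ι α (condExp α x) = gaugeAverage x := by
  have hι : Continuous (ι α) :=
    map_continuous (ι α)
  refine denseRange_mk.induction_on x (isClosed_eq
    (hι.comp (condExp α).continuous) continuous_gaugeAverage) fun a ↦ ?_
  rw [condExp_mk]
  induction a using SkewMonoidAlgebra.induction_on' with
  | add x y hx hy => rw [coeff_add, Finsupp.add_apply, map_add, hx, hy, mk_add, gaugeAverage_add]
  | single g a => exact (gaugeAverage_mk_single g a).symm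

end Gauge

end IntCrossedProduct

section States

variable {B : Type*} [CStarAlgebra B]

open scoped ComplexOrder in
/-- The states of a unital `C⋆`-algebra: positive linear functionals with `φ(1) = 1`. -/
def stateSpace (B : Type*) [CStarAlgebra B] : Set (StrongDual ℂ B) :=
  {φ | (∀ b : B, 0 ≤ φ (star b * b)) ∧ φ 1 = 1}

/-- The states which are invariant under the automorphism `Φ`. -/
def invariantStates (Φ : B ≃⋆ₐ[ℂ] B) : Set (StrongDual ℂ B) :=
  {φ ∈ stateSpace B | ∀ b : B, φ (Φ b) = φ b}

/-- `(B, Φ)` is uniquely ergodic, with `φ` as its unique invariant state. -/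
def IsUniquelyErgodicWith (Φ : B ≃⋆ₐ[ℂ] B) (φ : StrongDual ℂ B) : Prop :=
  invariantStates Φ = {φ}

/-- `(B, Φ, φ)` is ergodic: `φ` is an extreme point of the set of invariant states. -/
def IsErgodic (Φ : B ≃⋆ₐ[ℂ] B) (φ : StrongDual ℂ B) : Prop :=
  φ ∈ (invariantStates Φ).extremePoints ℝ

end States

end

/-! ### Extreme points and averages over an interval -/

noncomputable section

open IntCrossedProduct

/-! If `ω` is the only invariant state, it is an extreme point of a singleton. The content is the
converse.

Write `Φ` for the skew product and let `φ` be any `Φ`-invariant state. Since `Φ` acts on the copy of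
`A` as `θ`, the restriction of `φ` to `A` is `θ`-invariant, hence equal to `ω₀`. Therefore `ω = ω₀ ∘
E` is `φ` composed with the gauge average, that is, the mean of the functionals `φ ∘ ρ_z` over the
whole circle (`comp_ι_comp_condExp`). The gauge action commutes with `Φ` (`gauge_skewProduct`), so
every `φ ∘ ρ_z` is again an invariant state, and so is its mean over any arc
(`arcMean_mem_invariantStates`). An extreme point written as a continuous average of members of the
convex set must coincide with each of them; at `z = 1` this gives `ω = φ`.

The last principle needs no integral representation theory (`eq_of_mem_extremePoints_of_average`).
Cutting the circle into two arcs turns the average into an ordinary convex combination of two arc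
means, so extremality makes the mean over every initial arc equal to `ω`. Letting the arc shrink to
its starting point recovers `φ` by the fundamental theorem of calculus. -/

/-- An extreme point of a set of functionals which is the average over `[0, T]` of a norm-bounded
family, pointwise continuous in the parameter, is equal to the initial functional, provided that
the averages over all subintervals belong to the set. -/
theorem eq_of_mem_extremePoints_of_average {B : Type*} [NormedAddCommGroup B] [NormedSpace ℂ B]
    {S : Set (StrongDual ℂ B)} {ω : StrongDual ℂ B} (hω : ω ∈ S.extremePoints ℝ)
    {T : ℝ} (hT : 0 < T) {f : ℝ → B → ℂ} (hf : ∀ x, Continuous fun t ↦ f t x)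
    {M : ℝ → ℝ → StrongDual ℂ B} (hM : ∀ a b x, M a b x = (b - a)⁻¹ • ∫ t in a..b, f t x)
    (hMS : ∀ a b, a < b → M a b ∈ S) (hωM : ω = M 0 T) (x : B) : ω x = f 0 x := by
  -- The mean over `[0, T]` is a proper convex combination of the means over `[0, s]` and `[s, T]`,
  -- both in `S`; extremality forces the first of them to be `ω`.
  have hmean : ∀ s, 0 < s → s < T → M 0 s = ω := fun s hs hsT ↦ by
    refine (mem_extremePoints_iff_left.mp hω).2 _ (hMS 0 s hs) _ (hMS s T hsT) ?_
    -- The weights are the relative lengths of the two pieces: each turns the normalising factor of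
    -- its mean into the common factor `T⁻¹`, after which the integrals add up.
    refine ⟨s / T, (T - s) / T, by positivity, div_pos (sub_pos.mpr hsT) hT, by field_simp; ring,
      ?_⟩
    ext y
    have hint : ∀ a b, IntervalIntegrable (fun t ↦ f t y) MeasureTheory.volume a b :=
      fun a b ↦ (hf y).intervalIntegrable a b
    have hs' : T - s ≠ 0 := (sub_pos.mpr hsT).ne'
    have hs0 := hs.ne'
    rw [hωM, add_apply, smul_apply,
      smul_apply, hM, hM, hM, smul_smul, smul_smul, sub_zero, sub_zero,
      ← intervalIntegral.integral_add_adjacent_intervals (hint 0 s) (hint s T), smul_add]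
    congr 2 <;> field_simp
  have hderiv : HasDerivAt (fun s ↦ ∫ t in (0 : ℝ)..s, f t x) (f 0 x) 0 :=
    intervalIntegral.integral_hasDerivAt_right ((hf x).intervalIntegrable 0 0)
      ((hf x).stronglyMeasurableAtFilter _ _) (hf x).continuousAt
  -- Only slopes from the right are kept, because `hmean` concerns `s > 0`.
  have hslope := (hasDerivAt_iff_tendsto_slope.mp hderiv).mono_left
    (nhdsWithin_mono 0 fun s (hs : s ∈ Set.Ioi 0) ↦ (Set.mem_Ioi.mp hs).ne')
  -- The slope between `0` and `s` of the primitive is `M 0 s x`, which has the constant value `ω x`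
  -- for `0 < s < T`; its limit at `0` is the derivative `f 0 x`.
  refine tendsto_nhds_unique (tendsto_const_nhds.congr' ?_) hslope
  filter_upwards [Ioo_mem_nhdsGT hT] with s hs
  rw [← hmean s hs.1 hs.2, hM, slope_def_module, intervalIntegral.integral_same, sub_zero,
    sub_zero]

/-! ### Means of a functional along the gauge action -/

namespace IntCrossedProduct

variable {A : Type*} [CStarAlgebra A] {α : A ≃⋆ₐ[ℂ] A}

lemma continuous_apply_gauge_exp (φ : StrongDual ℂ (IntCrossedProduct α))
    (x : IntCrossedProduct α) : Continuous fun t : ℝ ↦ φ (gauge α (Circle.exp t) x) :=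
  φ.continuous.comp (continuous_gauge_exp x)

/-- The mean of `φ ∘ ρ_z` over the arc `z = exp(it)`, `t ∈ [a, b]`. -/
def arcMean (φ : StrongDual ℂ (IntCrossedProduct α)) (a b : ℝ) :
    StrongDual ℂ (IntCrossedProduct α) :=
  LinearMap.mkContinuous
    { toFun := fun x ↦ (b - a)⁻¹ • ∫ t in a..b, φ (gauge α (Circle.exp t) x)
      map_add' := fun x y ↦ by
        simp only [map_add]
        rw [intervalIntegral.integral_add
          ((continuous_apply_gauge_exp φ x).intervalIntegrable _ _)
          ((continuous_apply_gauge_exp φ y).intervalIntegrable _ _), smul_add]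
      map_smul' := fun c x ↦ by
        simp only [map_smul, RingHom.id_apply]
        rw [intervalIntegral.integral_smul, smul_comm] }
    -- The constant is not simplified to `‖φ‖` because `a` and `b` are arbitrary: for `a = b` the
    -- inverse is `0` and the mean is the zero functional.
    (|(b - a)⁻¹| * (‖φ‖ * |b - a|)) fun x ↦ by
      have h := intervalIntegral.norm_integral_le_of_norm_le_const (a := a) (b := b)
        (f := fun t : ℝ ↦ φ (gauge α (Circle.exp t) x)) (C := ‖φ‖ * ‖x‖) fun t _ ↦
          (φ.le_opNorm _).trans (by gcongr; exact norm_gauge_le _ x)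
      change ‖(b - a)⁻¹ • ∫ t in a..b, φ (gauge α (Circle.exp t) x)‖ ≤ _
      rw [norm_smul, Real.norm_eq_abs, mul_assoc]
      gcongr
      linarith

lemma arcMean_apply (φ : StrongDual ℂ (IntCrossedProduct α)) (a b : ℝ)
    (x : IntCrossedProduct α) :
    arcMean φ a b x = (b - a)⁻¹ • ∫ t in a..b, φ (gauge α (Circle.exp t) x) := rfl

/-- The gauge action commutes with the skew product. -/
lemma gauge_skewProduct (θ : A ≃⋆ₐ[ℂ] A) (u : unitary A)
    (hu : ∀ a, (u : A) * α (θ a) = θ (α a) * u) (z : Circle) (x : IntCrossedProduct α) :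
    gauge α z (skewProduct α θ u hu x) = skewProduct α θ u hu (gauge α z x) := by
  -- It suffices to compare generators: both composites send `a` to `θ a` and `V` to `z u V`, since
  -- the gauge action fixes `u ∈ A`.
  have h : (gauge α z).comp (skewHom α θ u hu) = (skewHom α θ u hu).comp (gauge α z) :=
    hom_ext (fun a ↦ by simp [gauge_ι]) (by simp [gauge_ι, gauge_V])
  exact DFunLike.congr_fun h x

lemma gauge_one (x : IntCrossedProduct α) : gauge α 1 x = x := by
  have h : gauge α 1 = StarAlgHom.id ℂ (IntCrossedProduct α) :=
    hom_ext (fun a ↦ by simp [gauge_ι]) (by simp [gauge_V])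
  exact DFunLike.congr_fun h x

-- Each `ρ_z` is a unital `⋆`-homomorphism, so the integrand is nonnegative at `star x * x` and
-- constantly `1` at `1`. Strictness of `a < b` is what normalises the mean: a degenerate arc gives
-- `0` at `1`.
open scoped ComplexOrder in
lemma arcMean_mem_stateSpace {φ : StrongDual ℂ (IntCrossedProduct α)}
    (hφ : φ ∈ stateSpace (IntCrossedProduct α)) {a b : ℝ} (hab : a < b) :
    arcMean φ a b ∈ stateSpace (IntCrossedProduct α) := by
  refine ⟨fun x ↦ ?_, ?_⟩
  · rw [arcMean_apply, intervalIntegral.integral_of_le hab.le]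
    refine smul_nonneg (inv_nonneg.mpr (sub_pos.mpr hab).le)
      (MeasureTheory.integral_nonneg fun t ↦ ?_)
    rw [Pi.zero_apply, map_mul, map_star]
    exact hφ.1 _
  · simp only [arcMean_apply, map_one, hφ.2]
    rw [intervalIntegral.integral_const, smul_smul, inv_mul_cancel₀ (sub_pos.mpr hab).ne', one_smul]

/-- Because the gauge action commutes with the skew product, invariance of `φ` passes to the
integrand at every point of the arc. -/
lemma arcMean_mem_invariantStates {θ : A ≃⋆ₐ[ℂ] A} {u : unitary A}
    {hu : ∀ a, (u : A) * α (θ a) = θ (α a) * u} {φ : StrongDual ℂ (IntCrossedProduct α)}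
    (hφ : φ ∈ invariantStates (skewProduct α θ u hu)) {a b : ℝ} (hab : a < b) :
    arcMean φ a b ∈ invariantStates (skewProduct α θ u hu) :=
  ⟨arcMean_mem_stateSpace hφ.1 hab, fun x ↦ by
    simp only [arcMean_apply, gauge_skewProduct, hφ.2]⟩

/-! ### Restriction to `A` and the conditional expectation -/

/-- The embedding of `A` into the crossed product, as a continuous linear map. -/
def ιCLM (α : A ≃⋆ₐ[ℂ] A) : A →L[ℂ] IntCrossedProduct α :=
  ⟨(ι α).toAlgHom.toLinearMap, map_continuous (ι α)⟩

lemma ιCLM_apply (a : A) : ιCLM α a = ι α a := rfl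

/-- The restriction to `A` of a state invariant under the skew product is invariant under `θ`. -/
lemma comp_ι_mem_invariantStates {θ : A ≃⋆ₐ[ℂ] A} {u : unitary A}
    {hu : ∀ a, (u : A) * α (θ a) = θ (α a) * u} {φ : StrongDual ℂ (IntCrossedProduct α)}
    (hφ : φ ∈ invariantStates (skewProduct α θ u hu)) :
    φ ∘L ιCLM α ∈ invariantStates θ := by
  refine ⟨⟨fun a ↦ ?_, ?_⟩, fun a ↦ ?_⟩
  · rw [ContinuousLinearMap.comp_apply, ιCLM_apply, map_mul, map_star]
    exact hφ.1.1 _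
  · rw [ContinuousLinearMap.comp_apply, ιCLM_apply, map_one]
    exact hφ.1.2
  · rw [ContinuousLinearMap.comp_apply, ContinuousLinearMap.comp_apply, ιCLM_apply, ιCLM_apply,
      ← skewProduct_ι θ u hu, hφ.2]

/-- The mean of `φ ∘ ρ_z` over the whole circle is `φ|_A ∘ E`. -/
lemma comp_ι_comp_condExp (φ : StrongDual ℂ (IntCrossedProduct α)) :
    (φ ∘L ιCLM α) ∘L condExp α = arcMean φ 0 (2 * Real.pi) := by
  ext x
  -- `ι ∘ E` is the vector-valued gauge average, and the continuous functional `φ` passes through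
  -- its integral.
  rw [ContinuousLinearMap.comp_apply, ContinuousLinearMap.comp_apply, ιCLM_apply, ι_condExp,
    gaugeAverage, arcMean_apply, sub_zero, φ.map_smul_of_tower,
    ContinuousLinearMap.intervalIntegral_comp_comm _
      ((continuous_gauge_exp x).intervalIntegrable _ _)]

end IntCrossedProduct

end

/-! ### The equivalence of unique ergodicity and ergodicity -/

theorem mainTheorem5 {A : Type*} [CStarAlgebra A] (θ α : A ≃⋆ₐ[ℂ] A) (u : unitary A)
    (hu : ∀ a : A, (u : A) * α (θ a) = θ (α a) * (u : A))
    (ω₀ : StrongDual ℂ A) (hω₀ : IsUniquelyErgodicWith θ ω₀) :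
    IsUniquelyErgodicWith (IntCrossedProduct.skewProduct α θ u hu)
        (ω₀ ∘L IntCrossedProduct.condExp α) ↔
      IsErgodic (IntCrossedProduct.skewProduct α θ u hu)
        (ω₀ ∘L IntCrossedProduct.condExp α) := by
  constructor
  · intro h
    rw [IsErgodic, h, extremePoints_singleton]
    rfl
  · intro h
    -- Ergodicity already contains the invariance of `ω`; what remains is that an arbitrary
    -- invariant state `φ` equals `ω`.
    refine Set.Subset.antisymm (fun φ hφ ↦ ?_) (Set.singleton_subset_iff.mpr h.1)
    -- Unique ergodicity of `(A, θ)` enters here: all invariant states of the crossed product agree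
    -- on `A`, hence have the same gauge average.
    have hres : φ ∘L IntCrossedProduct.ιCLM α = ω₀ := by
      have hmem := IntCrossedProduct.comp_ι_mem_invariantStates hφ
      rw [hω₀] at hmem
      exact hmem
    have hmean : ω₀ ∘L IntCrossedProduct.condExp α =
        IntCrossedProduct.arcMean φ 0 (2 * Real.pi) := by
      rw [← hres, IntCrossedProduct.comp_ι_comp_condExp]
    refine ContinuousLinearMap.ext fun x ↦ ?_
    -- The family is `t ↦ φ ∘ ρ_{exp(it)}` on `[0, 2π]`; its initial member is `φ ∘ ρ_1 = φ`.
    have hx := eq_of_mem_extremePoints_of_average h Real.two_pi_pos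
      (IntCrossedProduct.continuous_apply_gauge_exp φ)
      (IntCrossedProduct.arcMean_apply φ)
      (fun a b ↦ IntCrossedProduct.arcMean_mem_invariantStates hφ) hmean x
    rw [hx, Circle.exp_zero, IntCrossedProduct.gauge_one]
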